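/- Let $n\ge 1$, let $h\in\mathcal S(\mathbb R)$ be non-zero (complex-valued allowed) and $f\in\mathcal S(\mathbb R^n)$. Write $\hat h(\eta)=\int_{\mathbb R}h(t)e^{-it\eta}\,dt$, let $$I^{-1}h(t)=\frac1{2\pi}\int_{\mathbb R}|\eta|\,\hat h(\eta)\,e^{it\eta}\,d\eta$$ be the function with Fourier transform $|\eta|\hat h(\eta)$, and let $$P_hf(u,v)=\int_{\mathbb R}f(u+tv)\,h(t)\,dt,\qquad u\in\mathbb R^n,\ v\in\mathbb R^n\setminus\{0\},$$ be the windowed ray transform of $f$. Then for every $x\in\mathbb R^n$, $$f(x)=\pi^{-n/2}\,\Gamma(n/2)\left(\int_{\mathbb R}|\hat h(-t)|^2dt\right)^{-1}\int_{\mathbb R^n}\left(\int_{\mathbb R}P_hf(x-vt,v)\,\overline{I^{-1}h(t)}\,dt\right)|v|^{-n}\,dv ,$$ where the inner integral converges absolutely for each $v\neq0$ and the outer integral then converges absolutely. If $h$ is real-valued, the formula also holds with $I^{-1}h(t)$ in place of $\overline{I^{-1}h(t)}$. It is not required that $\hat h(0)=0$. -/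

import Mathlib

open MeasureTheory

open scoped SchwartzMap ComplexConjugate

noncomputable section

/-- The one-dimensional Fourier transform `ĥ(η) = ∫ h(t) e^{-i t η} dt` (angular frequency,
no normalizing factor). -/
def fourierHat (h : ℝ → ℂ) (η : ℝ) : ℂ :=
  ∫ t : ℝ, h t * Complex.exp (-(Complex.I * (t : ℂ) * (η : ℂ)))

/-- The function `I⁻¹h` whose Fourier transform is `|η| ĥ(η)`, that is,
`I⁻¹h(t) = (2π)⁻¹ ∫ |η| ĥ(η) e^{i t η} dη`. -/
def rieszInv (h : ℝ → ℂ) (t : ℝ) : ℂ :=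
  ((2 * Real.pi)⁻¹ : ℝ) *
    ∫ η : ℝ, ((|η| : ℝ) : ℂ) * fourierHat h η * Complex.exp (Complex.I * (t : ℂ) * (η : ℂ))

/-- The windowed ray transform `P_h f(u, v) = ∫ f(u + t v) h(t) dt`
(of interest for `v ≠ 0`). -/
def windowedRay {n : ℕ} (h : ℝ → ℂ) (f : EuclideanSpace ℝ (Fin n) → ℂ)
    (u v : EuclideanSpace ℝ (Fin n)) : ℂ :=
  ∫ t : ℝ, f (u + t • v) * h t

/-- The constant `π^{-n/2} Γ(n/2) (∫ |ĥ(-t)|² dt)⁻¹`. -/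
def inversionConst (n : ℕ) (h : ℝ → ℂ) : ℝ :=
  Real.pi ^ (-((n : ℝ) / 2)) * Real.Gamma ((n : ℝ) / 2) *
    (∫ t : ℝ, ‖fourierHat h (-t)‖ ^ 2)⁻¹

end

/-! Fourier inversion for `f` along a line turns the windowed ray transform into a multiplier: with
`F ξ = fourierAt f x ξ`, the inner integral is `∫ F ξ · 2π|⟪ξ, v⟫| |ĥ(-2π⟪ξ, v⟫)|² dξ`
(`integral_windowedRay_mul_conj_rieszInv`). Weighted by `|v|⁻ⁿ` and integrated over `v`, the
multiplier no longer depends on `ξ ≠ 0`: in polar coordinates the Jacobian and the two weights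
reduce to `|⟪ξ, θ⟫| dr`, the line element of `s = ⟪ξ, rθ⟫`, so each pair `±θ` contributes the same
line integral (`integral_ridge`). Fubini and inversion at `x` then leave a constant times `f x`. The
factor `|⟪ξ, v⟫|` coming from `I⁻¹` tames the singularity of `|v|⁻ⁿ` at the origin, hence no
condition on `ĥ(0)`.

Since `|η|` is not smooth, `rieszInv h` need not be Schwartz; the multiplier identity is proved for
Schwartz windows and passed to the limit through `√(η² + ε²)`. -/

open Set Metric Module Filter Topology
open scoped ENNReal FourierTransform RealInnerProductSpace

/-! ### Polar coordinates -/

section PolarCoordinates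

variable {E : Type*} [NormedAddCommGroup E] [NormedSpace ℝ E] [FiniteDimensional ℝ E]
  [MeasurableSpace E] [BorelSpace E]

/-- Integration of a nonnegative function in polar coordinates. -/
theorem lintegral_polar [Nontrivial E] (μ : Measure E) [μ.IsAddHaarMeasure] {F : E → ℝ≥0∞}
    (hF : Measurable F) :
    ∫⁻ v, F v ∂μ = ∫⁻ θ : sphere (0 : E) 1, (∫⁻ r in Ioi (0 : ℝ),
      ENNReal.ofReal (r ^ (finrank ℝ E - 1)) * F (r • (θ : E))) ∂μ.toSphere := by
  have h1 : ∫⁻ v, F v ∂μ = ∫⁻ v : ({0}ᶜ : Set E), F v ∂(μ.comap (↑)) := by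
    rw [lintegral_subtype_comap (measurableSet_singleton _).compl, restrict_compl_singleton]
  have h2 := (μ.measurePreserving_homeomorphUnitSphereProd).lintegral_comp
    (f := fun p : sphere (0 : E) 1 × Ioi (0 : ℝ) => F (p.2.1 • p.1.1)) (by fun_prop)
  rw [h1]
  have h3 : ∀ v : ({0}ᶜ : Set E), F v = F ((homeomorphUnitSphereProd E v).2.1 •
      (homeomorphUnitSphereProd E v).1.1) := by
    intro v
    congr 1
    have : ‖(v : E)‖ ≠ 0 := norm_ne_zero_iff.2 v.2
    simp [smul_smul, this]
  simp_rw [h3]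
  rw [h2, lintegral_prod _ (by fun_prop)]
  refine lintegral_congr fun θ => ?_
  rw [Measure.volumeIoiPow, lintegral_withDensity_eq_lintegral_mul _ (by fun_prop) (by fun_prop),
    ← lintegral_subtype_comap measurableSet_Ioi]
  rfl

theorem ae_toSphere_notMem_submodule (μ : Measure E) [μ.IsAddHaarMeasure] (s : Submodule ℝ E)
    (hs : s ≠ ⊤) : ∀ᵐ θ : sphere (0 : E) 1 ∂μ.toSphere, (θ : E) ∉ s := by
  have hm : MeasurableSet {θ : sphere (0 : E) 1 | (θ : E) ∈ s} :=
    measurable_subtype_coe s.closed_of_finiteDimensional.measurableSet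
  rw [ae_iff]
  simp only [not_not]
  rw [μ.toSphere_apply' hm, measure_mono_null _ (Measure.addHaar_submodule μ s hs), mul_zero]
  rintro _ ⟨r, -, _, ⟨θ, hθ, rfl⟩, rfl⟩
  exact s.smul_mem r hθ

end PolarCoordinates

/-- The points `ra` and `-ra`, `r > 0`, sweep out the two half-lines, whichever the sign of `a`. -/
theorem lintegral_Ioi_add_neg {q : ℝ → ℝ≥0∞} (hq : Measurable q) {a : ℝ} (ha : a ≠ 0) :
    ∫⁻ r in Ioi (0 : ℝ), ENNReal.ofReal |a| * (q (r * a) + q (-(r * a))) = ∫⁻ s, q s := by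
  have hneg : ∫⁻ r in Ioi (0 : ℝ), q (-(r * a)) = ∫⁻ r in Iio (0 : ℝ), q (r * a) := by
    have := (Measure.measurePreserving_neg (volume : Measure ℝ)).setLIntegral_comp_preimage
      (s := Iio 0) (f := fun r => q (r * a)) measurableSet_Iio (by fun_prop)
    simpa using this
  rw [lintegral_const_mul _ (by fun_prop), lintegral_add_left (by fun_prop), hneg, add_comm,
    restrict_Iio_eq_restrict_Iic, ← compl_Ioi, add_comm, lintegral_add_compl _ measurableSet_Ioi]
  conv_rhs => rw [← Real.smul_map_volume_mul_right ha]
  rw [lintegral_smul_measure, lintegral_map hq (by fun_prop), smul_eq_mul]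

/-! ### Ridge integrals of nonnegative functions -/

section Ridge

variable {E : Type*} [NormedAddCommGroup E] [InnerProductSpace ℝ E] [FiniteDimensional ℝ E]
  [MeasurableSpace E] [BorelSpace E]

/-- The integral of a homogeneous ridge function of degree `-dim E + 1`. -/
theorem two_mul_lintegral_ridge {ξ : E} (hξ : ξ ≠ 0) {q : ℝ → ℝ≥0∞} (hq : Measurable q) :
    2 * ∫⁻ v : E, ENNReal.ofReal ((‖v‖ ^ finrank ℝ E)⁻¹ * |⟪ξ, v⟫|) * q ⟪ξ, v⟫ =
      (volume : Measure E).toSphere univ * ∫⁻ s, q s := by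
  have : Nontrivial E := ⟨⟨ξ, 0, hξ⟩⟩
  set F : E → ℝ≥0∞ := fun v => ENNReal.ofReal ((‖v‖ ^ finrank ℝ E)⁻¹ * |⟪ξ, v⟫|) * q ⟪ξ, v⟫
  have hF : Measurable F := by fun_prop
  -- Pairing `v` with `-v` makes each radial half-line integral cover all of `ℝ`; this is the source
  -- of the factor 2.
  have hneg : ∫⁻ v, F v = ∫⁻ v, F (-v) :=
    ((Measure.measurePreserving_neg (volume : Measure E)).lintegral_comp hF).symm
  have hsum : 2 * ∫⁻ v, F v = ∫⁻ v, (F v + F (-v)) := by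
    rw [lintegral_add_left hF, ← hneg, two_mul]
  rw [hsum, lintegral_polar volume (by fun_prop)]
  have hker : (LinearMap.ker (innerₛₗ ℝ ξ)) ≠ ⊤ := by
    intro h
    have : ξ ∈ LinearMap.ker (innerₛₗ ℝ ξ) := h ▸ Submodule.mem_top
    simp [hξ] at this
  rw [mul_comm, ← lintegral_const]
  refine lintegral_congr_ae ?_
  filter_upwards [ae_toSphere_notMem_submodule (volume : Measure E) _ hker] with θ hθ
  have ha : ⟪ξ, (θ : E)⟫ ≠ 0 := by simpa using hθ
  rw [← lintegral_Ioi_add_neg hq ha]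
  refine setLIntegral_congr_fun measurableSet_Ioi fun r hr => ?_
  have hr : 0 < r := hr
  have hθ1 : ‖(θ : E)‖ = 1 := by simp
  have hd : 0 < finrank ℝ E := finrank_pos
  -- All powers of `r` cancel: `r^(d-1) · r^(-d) · r = 1`.
  have hpow : r ^ (finrank ℝ E - 1) * ((r ^ finrank ℝ E)⁻¹ * (r * |⟪ξ, (θ : E)⟫|)) =
      |⟪ξ, (θ : E)⟫| := by
    have : r ^ finrank ℝ E = r ^ (finrank ℝ E - 1) * r := by
      rw [← pow_succ, Nat.sub_add_cancel hd]
    rw [this]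
    field_simp
  simp only [F, norm_neg, inner_neg_right, abs_neg, norm_smul, hθ1, mul_one, real_inner_smul_right,
    Real.norm_eq_abs, abs_mul, abs_of_pos hr, ← mul_add]
  rw [← mul_assoc, ← ENNReal.ofReal_mul (by positivity), hpow]

end Ridge

/-! ### Angular-frequency Fourier transform on the line -/

/-- The inverse of `fourierHat`, as an integral. -/
noncomputable def fourierHatInv (G : ℝ → ℂ) (t : ℝ) : ℂ :=
  ((2 * Real.pi)⁻¹ : ℝ) * ∫ η : ℝ, G η * Complex.exp (Complex.I * (t : ℂ) * (η : ℂ))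

theorem fourierHat_eq_fourier (h : ℝ → ℂ) (η : ℝ) :
    fourierHat h η = 𝓕 h ((2 * Real.pi)⁻¹ * η) := by
  rw [Real.fourier_real_eq_integral_exp_smul, fourierHat]
  congr 1 with t
  rw [smul_eq_mul, mul_comm]
  congr 2
  push_cast
  have : (Real.pi : ℂ) ≠ 0 := by exact_mod_cast Real.pi_ne_zero
  field_simp

/-- Dilation of a Schwartz function. -/
theorem SchwartzMap.exists_comp_mul_left (G : 𝓢(ℝ, ℂ)) {c : ℝ} (hc : c ≠ 0) :
    ∃ A : 𝓢(ℝ, ℂ), ∀ η, A η = G (c * η) :=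
  ⟨SchwartzMap.compCLMOfContinuousLinearEquiv ℂ
    (ContinuousLinearEquiv.smulLeft (Units.mk0 c hc)) G, fun _ => rfl⟩

theorem exists_schwartzMap_eq_fourierHat (h : 𝓢(ℝ, ℂ)) :
    ∃ A : 𝓢(ℝ, ℂ), fourierHat h = A := by
  obtain ⟨A, hA⟩ := (𝓕 h).exists_comp_mul_left (c := (2 * Real.pi)⁻¹) (by positivity)
  refine ⟨A, funext fun η => ?_⟩
  rw [hA, fourierHat_eq_fourier, SchwartzMap.fourier_coe]

theorem exists_schwartzMap_eq_fourierHatInv (G : 𝓢(ℝ, ℂ)) :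
    ∃ γ : 𝓢(ℝ, ℂ), fourierHatInv G = γ ∧ fourierHat γ = G := by
  have hpi : (2 * Real.pi) ≠ 0 := by positivity
  obtain ⟨A, hA⟩ := G.exists_comp_mul_left hpi
  refine ⟨𝓕⁻ A, funext fun t => ?_, funext fun ω => ?_⟩
  · rw [SchwartzMap.fourierInv_coe, Real.fourierInv_eq', fourierHatInv]
    have := Measure.integral_comp_mul_left
      (fun η : ℝ => G η * Complex.exp (Complex.I * (t : ℂ) * (η : ℂ))) (2 * Real.pi)
    rw [abs_of_pos (by positivity), Complex.real_smul] at this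
    rw [← this]
    congr 1 with η
    rw [hA, smul_eq_mul, mul_comm]
    congr 2
    simp
    ring
  · rw [fourierHat_eq_fourier, ← SchwartzMap.fourier_coe, FourierTransform.fourier_fourierInv_eq,
      hA, mul_inv_cancel_left₀ hpi]

theorem MeasureTheory.Integrable.phase_mul_prod {α β : Type*} [MeasurableSpace α]
    [MeasurableSpace β] {μ : Measure α} {ν : Measure β} [SFinite μ] [SFinite ν]
    {a : α → ℂ} {b : β → ℂ} (ha : Integrable a μ) (hb : Integrable b ν) {φ : α × β → ℂ}
    (hφ : AEStronglyMeasurable φ (μ.prod ν)) (h1 : ∀ p, ‖φ p‖ = 1) :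
    Integrable (fun p : α × β => φ p * (a p.1 * b p.2)) (μ.prod ν) :=
  (ha.mul_prod hb).bdd_mul (c := 1) hφ (Eventually.of_forall fun p => (h1 p).le)

theorem Complex.norm_exp_I_mul_ofReal_mul_ofReal (s w : ℝ) :
    ‖Complex.exp (Complex.I * (s : ℂ) * (w : ℂ))‖ = 1 := by
  rw [mul_assoc, ← Complex.ofReal_mul, Complex.norm_exp_I_mul_ofReal]

theorem Complex.norm_exp_neg_I_mul_ofReal_mul_ofReal (s w : ℝ) :
    ‖Complex.exp (-(Complex.I * (s : ℂ) * (w : ℂ)))‖ = 1 := by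
  simpa using Complex.norm_exp_I_mul_ofReal_mul_ofReal (-s) w

/-! ### The windowed ray transform on the Fourier side -/

section Ray

variable {n : ℕ}

local notation "V" => EuclideanSpace ℝ (Fin n)

/-- The Fourier transform of a Schwartz function `f` translated by `-x`. -/
noncomputable def fourierAt (f : 𝓢(V, ℂ)) (x ξ : V) : ℂ :=
  Complex.exp (((2 * Real.pi * ⟪ξ, x⟫ : ℝ) : ℂ) * Complex.I) * 𝓕 f ξ

theorem norm_fourierAt (f : 𝓢(V, ℂ)) (x ξ : V) : ‖fourierAt f x ξ‖ = ‖𝓕 f ξ‖ := by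
  rw [fourierAt, norm_mul, Complex.norm_exp_ofReal_mul_I, one_mul]

theorem continuous_fourierAt (f : 𝓢(V, ℂ)) (x : V) : Continuous (fourierAt f x) := by
  unfold fourierAt
  have := (𝓕 f).continuous
  fun_prop

theorem integrable_fourierAt (f : 𝓢(V, ℂ)) (x : V) : Integrable (fourierAt f x) :=
  (𝓕 f).integrable.congr' (continuous_fourierAt f x).aestronglyMeasurable
    (Eventually.of_forall fun ξ => (norm_fourierAt f x ξ).symm)

theorem integral_fourierAt (f : 𝓢(V, ℂ)) (x : V) : ∫ ξ, fourierAt f x ξ = f x := by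
  have h := congrArg (fun g : 𝓢(V, ℂ) => g x)
    (FourierTransform.fourierInv_fourier_eq (F := 𝓢(V, ℂ)) f)
  simp only [SchwartzMap.fourierInv_coe, Real.fourierInv_eq'] at h
  exact h

theorem fourierAt_add_smul (f : 𝓢(V, ℂ)) (x v ξ : V) (s : ℝ) :
    fourierAt f (x + s • v) ξ =
      Complex.exp (Complex.I * (s : ℂ) * ((2 * Real.pi * ⟪ξ, v⟫ : ℝ) : ℂ)) * fourierAt f x ξ := by
  rw [fourierAt, fourierAt, ← mul_assoc, ← Complex.exp_add, inner_add_right, real_inner_smul_right]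
  congr 2
  push_cast
  ring

/-- Moving along the line multiplies `fourierAt` by a phase, and integrating that phase against `h`
produces `ĥ`. -/
theorem windowedRay_eq_integral_fourierAt (h : 𝓢(ℝ, ℂ)) (f : 𝓢(V, ℂ)) (u v : V) :
    windowedRay h f u v =
      ∫ ξ, fourierAt f u ξ * fourierHat h (-(2 * Real.pi * ⟪ξ, v⟫)) := by
  have hint := (h.integrable (μ := volume)).phase_mul_prod (integrable_fourierAt f u)
    (φ := fun p : ℝ × V =>
      Complex.exp (Complex.I * (p.1 : ℂ) * ((2 * Real.pi * ⟪p.2, v⟫ : ℝ) : ℂ)))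
    (Continuous.aestronglyMeasurable (by fun_prop))
    (fun p => Complex.norm_exp_I_mul_ofReal_mul_ofReal _ _)
  have hswap := integral_integral_swap (f := fun (s : ℝ) (ξ : V) =>
    Complex.exp (Complex.I * (s : ℂ) * ((2 * Real.pi * ⟪ξ, v⟫ : ℝ) : ℂ)) *
      (h s * fourierAt f u ξ)) hint
  calc windowedRay h f u v
      = ∫ s : ℝ, ∫ ξ : V, Complex.exp (Complex.I * (s : ℂ) * ((2 * Real.pi * ⟪ξ, v⟫ : ℝ) : ℂ)) *
          (h s * fourierAt f u ξ) := by
        rw [windowedRay]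
        congr 1 with s
        rw [← integral_fourierAt f, ← integral_mul_const]
        congr 1 with ξ
        rw [fourierAt_add_smul]
        ring
    _ = _ := by
        rw [hswap]
        congr 1 with ξ
        rw [fourierHat, ← integral_const_mul]
        congr 1 with s
        push_cast
        rw [mul_neg, neg_neg]
        ring

theorem integrable_mul_schwartzMap_comp {g : V → ℂ} (hg : Integrable g) (A : 𝓢(ℝ, ℂ)) {w : V → ℝ}
    (hw : Continuous w) : Integrable (fun ξ => g ξ * A (w ξ)) :=
  hg.mul_bdd (c := SchwartzMap.seminorm ℝ 0 0 A)
    (A.continuous.comp hw).aestronglyMeasurable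
    (Eventually.of_forall fun _ => A.norm_le_seminorm ℝ _)

theorem windowedRay_sub_smul (h : 𝓢(ℝ, ℂ)) (f : 𝓢(V, ℂ)) (x v : V) (t : ℝ) :
    windowedRay h f (x - t • v) v =
      ∫ ξ, Complex.exp (-(Complex.I * (t : ℂ) * ((2 * Real.pi * ⟪ξ, v⟫ : ℝ) : ℂ))) *
        (fourierAt f x ξ * fourierHat h (-(2 * Real.pi * ⟪ξ, v⟫))) := by
  rw [windowedRay_eq_integral_fourierAt, sub_eq_add_neg, ← neg_smul]
  congr 1 with ξ
  rw [fourierAt_add_smul, mul_assoc]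
  push_cast
  rw [mul_neg, neg_mul]

theorem conj_fourierHat (h : ℝ → ℂ) (ω : ℝ) :
    conj (fourierHat h ω) = ∫ t, conj (h t) * Complex.exp (Complex.I * (t : ℂ) * (ω : ℂ)) := by
  rw [fourierHat, ← integral_conj]
  congr 1 with t
  rw [map_mul, ← Complex.exp_conj]
  simp

/-- The phase from the shift by `-t • v` pairs with `conj γ` to give the conjugate of `γ̂` at the
same frequency. Integrability of `γ` justifies Fubini. -/
theorem integral_windowedRay_mul_conj (h γ : 𝓢(ℝ, ℂ)) (f : 𝓢(V, ℂ)) (x v : V) :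
    ∫ t : ℝ, windowedRay h f (x - t • v) v * conj (γ t) =
      ∫ ξ, fourierAt f x ξ * fourierHat h (-(2 * Real.pi * ⟪ξ, v⟫)) *
        conj (fourierHat γ (-(2 * Real.pi * ⟪ξ, v⟫))) := by
  obtain ⟨A, hA⟩ := exists_schwartzMap_eq_fourierHat h
  have hγ : Integrable (fun t => conj (γ t)) volume :=
    (Complex.conjLIE.toContinuousLinearEquiv.toContinuousLinearMap).integrable_comp γ.integrable
  have hint := hγ.phase_mul_prod
    (integrable_mul_schwartzMap_comp (integrable_fourierAt f x) A
      (w := fun ξ => -(2 * Real.pi * ⟪ξ, v⟫)) (by fun_prop))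
    (φ := fun p : ℝ × V =>
      Complex.exp (-(Complex.I * (p.1 : ℂ) * ((2 * Real.pi * ⟪p.2, v⟫ : ℝ) : ℂ))))
    (Continuous.aestronglyMeasurable (by fun_prop))
    (fun p => Complex.norm_exp_neg_I_mul_ofReal_mul_ofReal _ _)
  rw [← hA] at hint
  have hswap := integral_integral_swap (f := fun (t : ℝ) (ξ : V) =>
    Complex.exp (-(Complex.I * (t : ℂ) * ((2 * Real.pi * ⟪ξ, v⟫ : ℝ) : ℂ))) *
      (conj (γ t) * (fourierAt f x ξ * fourierHat h (-(2 * Real.pi * ⟪ξ, v⟫))))) hint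
  calc ∫ t : ℝ, windowedRay h f (x - t • v) v * conj (γ t)
      = ∫ t : ℝ, ∫ ξ : V,
          Complex.exp (-(Complex.I * (t : ℂ) * ((2 * Real.pi * ⟪ξ, v⟫ : ℝ) : ℂ))) *
          (conj (γ t) * (fourierAt f x ξ * fourierHat h (-(2 * Real.pi * ⟪ξ, v⟫)))) := by
        congr 1 with t
        rw [windowedRay_sub_smul, ← integral_mul_const]
        congr 1 with ξ
        ring
    _ = _ := by
        rw [hswap]
        congr 1 with ξ
        rw [conj_fourierHat, ← integral_const_mul]
        congr 1 with t
        push_cast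
        rw [mul_neg]
        ring

theorem exists_schwartzMap_comp_line (f : 𝓢(V, ℂ)) (x : V) {v : V} (hv : v ≠ 0) :
    ∃ a : 𝓢(ℝ, ℂ), ∀ r, a r = f (x + r • v) := by
  have hg : (fun r : ℝ => x + r • v).HasTemperateGrowth := by fun_prop
  have h'g : AntilipschitzWith ‖v‖₊⁻¹ (fun r : ℝ => x + r • v) := by
    refine AntilipschitzWith.of_le_mul_dist fun r s => ?_
    have : ‖v‖ ≠ 0 := norm_ne_zero_iff.2 hv
    rw [dist_add_left, dist_eq_norm, dist_eq_norm, ← sub_smul, norm_smul, NNReal.coe_inv,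
      coe_nnnorm]
    field_simp
    rfl
  exact ⟨SchwartzMap.compCLMOfAntilipschitz ℂ hg h'g f, fun r => rfl⟩

/-- As a function of `t` this is `h` convolved with the reflection of `f` restricted to the line, a
Schwartz function because `v ≠ 0`. -/
theorem integrable_windowedRay_sub_smul (h : 𝓢(ℝ, ℂ)) (f : 𝓢(V, ℂ)) (x : V) {v : V} (hv : v ≠ 0) :
    Integrable (fun t : ℝ => windowedRay h f (x - t • v) v) := by
  obtain ⟨a, ha⟩ := exists_schwartzMap_comp_line f x hv
  have hconv := (h.integrable (μ := volume)).integrable_convolution (ContinuousLinearMap.mul ℝ ℂ)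
    (a.integrable (μ := volume)).comp_neg
  refine hconv.congr (Eventually.of_forall fun t => ?_)
  simp only [convolution, ContinuousLinearMap.mul_apply', windowedRay]
  congr 1 with s
  rw [ha, mul_comm]
  congr 2
  module

end Ray

/-! ### Smoothing the multiplier `|η|` -/

theorem exists_schwartzMap_sqrt_mul (A : 𝓢(ℝ, ℂ)) {ε : ℝ} (hε : 0 < ε) :
    ∃ G : 𝓢(ℝ, ℂ), ∀ η, G η = (√(η ^ 2 + ε ^ 2) : ℂ) * A η := by
  have h1 : (fun y : ℝ => (1 + ‖y‖ ^ 2) ^ (1 / 2 : ℝ)).HasTemperateGrowth :=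
    Function.hasTemperateGrowth_one_add_norm_sq_rpow ℝ _
  have h2 : (fun η : ℝ => ε⁻¹ * η).HasTemperateGrowth := by fun_prop
  have h3 : (fun η : ℝ => ε * (1 + ‖ε⁻¹ * η‖ ^ 2) ^ (1 / 2 : ℝ)).HasTemperateGrowth :=
    (Function.HasTemperateGrowth.const ε).mul (h1.comp h2)
  refine ⟨SchwartzMap.smulLeftCLM ℂ
    (fun η : ℝ => ε * (1 + ‖ε⁻¹ * η‖ ^ 2) ^ (1 / 2 : ℝ)) A, fun η => ?_⟩
  rw [SchwartzMap.smulLeftCLM_apply_apply h3, Complex.real_smul]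
  congr 2
  rw [← Real.sqrt_eq_rpow]
  nth_rewrite 1 [← Real.sqrt_sq hε.le]
  rw [← Real.sqrt_mul (by positivity), Real.norm_eq_abs, sq_abs]
  congr 1
  field_simp
  ring

theorem norm_fourierHatInv_le (G : ℝ → ℂ) (t : ℝ) :
    ‖fourierHatInv G t‖ ≤ (2 * Real.pi)⁻¹ * ∫ η, ‖G η‖ := by
  rw [fourierHatInv, norm_mul, Complex.norm_real, Real.norm_of_nonneg (by positivity)]
  gcongr
  refine (norm_integral_le_integral_norm _).trans_eq ?_
  simp [Complex.norm_exp_I_mul_ofReal_mul_ofReal]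

theorem continuous_fourierHatInv {G : ℝ → ℂ} (hG : Integrable G) :
    Continuous (fourierHatInv G) := by
  refine continuous_const.mul (continuous_of_dominated (bound := fun η => ‖G η‖) (fun t => ?_)
    (fun t => ?_) hG.norm (Eventually.of_forall fun η => by fun_prop))
  · exact hG.aestronglyMeasurable.mul (Continuous.aestronglyMeasurable (by fun_prop))
  · exact Eventually.of_forall fun η => by
      rw [norm_mul, Complex.norm_exp_I_mul_ofReal_mul_ofReal, mul_one]

/-- The multiplier `|η|` on a Schwartz function is a dominated pointwise limit of Schwartz
functions. -/
theorem exists_schwartzMap_tendsto_abs_mul (A : 𝓢(ℝ, ℂ)) :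
    ∃ G : ℕ → 𝓢(ℝ, ℂ), (∀ k η, ‖G k η‖ ≤ ‖G 0 η‖) ∧
      ∀ η, Tendsto (fun k => G k η) atTop (𝓝 (((|η| : ℝ) : ℂ) * A η)) := by
  -- With `ε = 1/(k+1)` the multipliers decrease in `k`, so `G 0` (`ε = 1`) dominates.
  choose G hG using fun k : ℕ => exists_schwartzMap_sqrt_mul A (Nat.one_div_pos_of_nat (n := k))
  refine ⟨G, fun k η => ?_, fun η => ?_⟩
  · rw [hG, hG, norm_mul, norm_mul, Complex.norm_real, Complex.norm_real,
      Real.norm_of_nonneg (Real.sqrt_nonneg _), Real.norm_of_nonneg (Real.sqrt_nonneg _)]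
    gcongr
    simp
  · simp_rw [hG]
    refine Tendsto.mul_const _ ((Complex.continuous_ofReal.tendsto _).comp ?_)
    have h0 := (tendsto_one_div_add_atTop_nhds_zero_nat (𝕜 := ℝ)).pow 2
    have := (Real.continuous_sqrt.tendsto _).comp (h0.const_add (η ^ 2))
    simpa [Real.sqrt_sq_eq_abs, Function.comp_def] using this

theorem rieszInv_eq_fourierHatInv (h : ℝ → ℂ) :
    rieszInv h = fourierHatInv (fun η => ((|η| : ℝ) : ℂ) * fourierHat h η) := rfl

theorem integrable_abs_mul_fourierHat (h : 𝓢(ℝ, ℂ)) :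
    Integrable (fun η => ((|η| : ℝ) : ℂ) * fourierHat h η) := by
  obtain ⟨A, hA⟩ := exists_schwartzMap_eq_fourierHat h
  have hc := A.continuous
  rw [hA]
  refine (A.integrable_pow_mul volume 1).congr'
    (Continuous.aestronglyMeasurable (by fun_prop)) (Eventually.of_forall fun η => ?_)
  simp

/-! ### Passage to the limit in the inner integral -/

section Ray

variable {n : ℕ}

local notation "V" => EuclideanSpace ℝ (Fin n)

theorem integrable_windowedRay_mul_conj_rieszInv (h : 𝓢(ℝ, ℂ)) (f : 𝓢(V, ℂ)) (x : V) {v : V}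
    (hv : v ≠ 0) :
    Integrable (fun t : ℝ => windowedRay h f (x - t • v) v * conj (rieszInv h t)) := by
  rw [rieszInv_eq_fourierHatInv]
  refine (integrable_windowedRay_sub_smul h f x hv).mul_bdd
    (Complex.continuous_conj.comp
      (continuous_fourierHatInv (integrable_abs_mul_fourierHat h))).aestronglyMeasurable
    (Eventually.of_forall fun t => ?_)
    (c := (2 * Real.pi)⁻¹ * ∫ η, ‖((|η| : ℝ) : ℂ) * fourierHat h η‖)
  simpa using norm_fourierHatInv_le (fun η => ((|η| : ℝ) : ℂ) * fourierHat h η) t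

/-- Both sides are limits of the identity for Schwartz `γ k` with transforms `G k`. On the left `γ
k` is bounded uniformly by the `L¹` norm of `G 0`; on the right `G 0` dominates pointwise. -/
theorem integral_windowedRay_mul_conj_rieszInv (h : 𝓢(ℝ, ℂ)) (f : 𝓢(V, ℂ)) (x : V) {v : V}
    (hv : v ≠ 0) :
    ∫ t : ℝ, windowedRay h f (x - t • v) v * conj (rieszInv h t) =
      ∫ ξ, fourierAt f x ξ *
        ((2 * Real.pi * |⟪ξ, v⟫| * ‖fourierHat h (-(2 * Real.pi * ⟪ξ, v⟫))‖ ^ 2 : ℝ) : ℂ) := by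
  obtain ⟨A, hA⟩ := exists_schwartzMap_eq_fourierHat h
  obtain ⟨G, hle, hlim⟩ := exists_schwartzMap_tendsto_abs_mul A
  choose γ hγ hγG using fun k => exists_schwartzMap_eq_fourierHatInv (G k)
  have hP := integrable_windowedRay_sub_smul h f x hv
  have hlimγ : ∀ t, Tendsto (fun k => γ k t) atTop (𝓝 (rieszInv h t)) := by
    intro t
    simp_rw [← hγ]
    rw [rieszInv_eq_fourierHatInv, hA]
    refine Tendsto.const_mul _ (tendsto_integral_of_dominated_convergence (fun η => ‖G 0 η‖)
      (fun k => ?_) (G 0).integrable.norm (fun k => Eventually.of_forall fun η => ?_)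
      (Eventually.of_forall fun η => (hlim η).mul_const _))
    · have := (G k).continuous
      exact Continuous.aestronglyMeasurable (by fun_prop)
    · rw [norm_mul, Complex.norm_exp_I_mul_ofReal_mul_ofReal, mul_one]
      exact hle k η
  have hL : Tendsto (fun k => ∫ t : ℝ, windowedRay h f (x - t • v) v * conj (γ k t)) atTop
      (𝓝 (∫ t : ℝ, windowedRay h f (x - t • v) v * conj (rieszInv h t))) := by
    refine tendsto_integral_of_dominated_convergence
      (fun t => ‖windowedRay h f (x - t • v) v‖ * ((2 * Real.pi)⁻¹ * ∫ η, ‖G 0 η‖))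
      (fun k => ?_) (hP.norm.mul_const _) (fun k => Eventually.of_forall fun t => ?_)
      (Eventually.of_forall fun t =>
        ((Complex.continuous_conj.tendsto _).comp (hlimγ t)).const_mul _)
    · exact hP.aestronglyMeasurable.mul
        (Complex.continuous_conj.comp (γ k).continuous).aestronglyMeasurable
    · rw [norm_mul, RCLike.norm_conj, ← hγ]
      gcongr
      refine (norm_fourierHatInv_le _ t).trans ?_
      exact mul_le_mul_of_nonneg_left
        (integral_mono (G k).integrable.norm (G 0).integrable.norm (hle k)) (by positivity)
  have hR : Tendsto (fun k => ∫ ξ, fourierAt f x ξ * A (-(2 * Real.pi * ⟪ξ, v⟫)) *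
      conj (G k (-(2 * Real.pi * ⟪ξ, v⟫)))) atTop
      (𝓝 (∫ ξ, fourierAt f x ξ * A (-(2 * Real.pi * ⟪ξ, v⟫)) *
        conj (((|-(2 * Real.pi * ⟪ξ, v⟫)| : ℝ) : ℂ) * A (-(2 * Real.pi * ⟪ξ, v⟫))))) := by
    have hw : Continuous fun ξ : V => -(2 * Real.pi * ⟪ξ, v⟫) := by fun_prop
    have hB := integrable_mul_schwartzMap_comp (integrable_fourierAt f x) A hw
    refine tendsto_integral_of_dominated_convergence
      (fun ξ => ‖fourierAt f x ξ * A (-(2 * Real.pi * ⟪ξ, v⟫)) * G 0 (-(2 * Real.pi * ⟪ξ, v⟫))‖)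
      (fun k => ?_) (integrable_mul_schwartzMap_comp hB (G 0) hw).norm
      (fun k => Eventually.of_forall fun ξ => ?_)
      (Eventually.of_forall fun ξ =>
        ((Complex.continuous_conj.tendsto _).comp (hlim _)).const_mul _)
    · exact hB.aestronglyMeasurable.mul
        (Complex.continuous_conj.comp ((G k).continuous.comp hw)).aestronglyMeasurable
    · rw [norm_mul, norm_mul _ (G 0 _), RCLike.norm_conj]
      gcongr
      exact hle k _
  have hEq : ∀ k, ∫ t : ℝ, windowedRay h f (x - t • v) v * conj (γ k t) =
      ∫ ξ, fourierAt f x ξ * A (-(2 * Real.pi * ⟪ξ, v⟫)) *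
        conj (G k (-(2 * Real.pi * ⟪ξ, v⟫))) := by
    intro k
    rw [integral_windowedRay_mul_conj, hγG, hA]
  simp_rw [hEq] at hL
  rw [tendsto_nhds_unique hL hR, hA]
  congr 1 with ξ
  rw [map_mul, Complex.conj_ofReal, mul_assoc, mul_left_comm (A _), Complex.mul_conj']
  rw [abs_neg, abs_mul, abs_of_pos (a := 2 * Real.pi) (by positivity)]
  push_cast
  ring

end Ray

/-! ### Positivity of the normalization, and real windows -/

theorem SchwartzMap.integrable_norm_sq (A : 𝓢(ℝ, ℂ)) : Integrable (fun t => ‖A t‖ ^ 2) := by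
  simpa using (A.memLp 2).integrable_norm_pow (by norm_num)

theorem fourierHat_ne_zero {h : 𝓢(ℝ, ℂ)} (hh : h ≠ 0) : fourierHat h ≠ 0 := by
  intro h0
  apply hh
  have hF : 𝓕 h = 0 := by
    ext w
    have := congrFun h0 (2 * Real.pi * w)
    rw [fourierHat_eq_fourier, inv_mul_cancel_left₀ (by positivity)] at this
    exact this
  rw [← FourierTransform.fourierInv_fourier_eq (F := 𝓢(ℝ, ℂ)) h, hF]
  exact (FourierTransform.fourierInvCLM ℂ 𝓢(ℝ, ℂ)).map_zero

theorem integrable_norm_sq_fourierHat_neg (h : 𝓢(ℝ, ℂ)) :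
    Integrable (fun t => ‖fourierHat h (-t)‖ ^ 2) := by
  obtain ⟨A, hA⟩ := exists_schwartzMap_eq_fourierHat h
  rw [hA]
  exact A.integrable_norm_sq.comp_neg

theorem integral_norm_sq_fourierHat_neg_ne_zero {h : 𝓢(ℝ, ℂ)} (hh : h ≠ 0) :
    ∫ t : ℝ, ‖fourierHat h (-t)‖ ^ 2 ≠ 0 := by
  intro h0
  rw [integral_eq_zero_iff_of_nonneg (fun _ => by positivity)
    (integrable_norm_sq_fourierHat_neg h)] at h0
  refine fourierHat_ne_zero hh (funext fun t => ?_)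
  have hc : Continuous fun t : ℝ => ‖fourierHat h (-t)‖ ^ 2 := by
    obtain ⟨A, hA⟩ := exists_schwartzMap_eq_fourierHat h
    have := A.continuous
    rw [hA]
    fun_prop
  have := congrFun ((hc.ae_eq_iff_eq volume continuous_zero).1 h0) (-t)
  simpa using this

/-- For real `h`, conjugating `ĥ` reflects its argument; `|η|` is even, so `η ↦ -η` restores the
integral. -/
theorem conj_rieszInv_of_real {h : ℝ → ℂ} (hr : ∀ t, conj (h t) = h t) (t : ℝ) :
    conj (rieszInv h t) = rieszInv h t := by
  have hhat : ∀ η, conj (fourierHat h η) = fourierHat h (-η) := by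
    intro η
    rw [conj_fourierHat, fourierHat]
    simp [hr]
  rw [rieszInv, map_mul, Complex.conj_ofReal, ← integral_conj, ← integral_neg_eq_self]
  congr 2 with η
  rw [map_mul, map_mul, hhat, Complex.conj_ofReal, ← Complex.exp_conj]
  simp

/-! ### Ridge integrals of real functions, and the constant -/

section Ridge

variable {E : Type*} [NormedAddCommGroup E] [InnerProductSpace ℝ E] [FiniteDimensional ℝ E]
  [MeasurableSpace E] [BorelSpace E]

theorem lintegral_ridge {ξ : E} (hξ : ξ ≠ 0) {q : ℝ → ℝ} (hq : Measurable q)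
    (hq0 : 0 ≤ q) (hqi : Integrable q) :
    ∫⁻ v : E, ENNReal.ofReal ((‖v‖ ^ finrank ℝ E)⁻¹ * |⟪ξ, v⟫| * q ⟪ξ, v⟫) =
      ENNReal.ofReal ((volume : Measure E).toSphere.real univ / 2 * ∫ s, q s) := by
  have h := two_mul_lintegral_ridge hξ (q := fun s => ENNReal.ofReal (q s)) (by fun_prop)
  rw [← ofReal_integral_eq_lintegral_ofReal hqi (Eventually.of_forall hq0)] at h
  have hS : (volume : Measure E).toSphere univ =
      2 * ENNReal.ofReal ((volume : Measure E).toSphere.real univ / 2) := by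
    rw [← ENNReal.ofReal_ofNat, ← ENNReal.ofReal_mul (by norm_num), mul_div_cancel₀ _ (by norm_num),
      ofReal_measureReal]
  rw [hS, mul_assoc, ENNReal.mul_right_inj (by norm_num) (by norm_num),
    ← ENNReal.ofReal_mul (by positivity)] at h
  rw [← h]
  refine lintegral_congr fun v => ?_
  rw [ENNReal.ofReal_mul (by positivity)]

theorem integrable_ridge {ξ : E} (hξ : ξ ≠ 0) {q : ℝ → ℝ} (hq : Measurable q)
    (hq0 : 0 ≤ q) (hqi : Integrable q) :
    Integrable fun v : E => (‖v‖ ^ finrank ℝ E)⁻¹ * |⟪ξ, v⟫| * q ⟪ξ, v⟫ := by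
  refine ⟨Measurable.aestronglyMeasurable (by fun_prop), ?_⟩
  rw [hasFiniteIntegral_iff_ofReal (Eventually.of_forall fun v => ?_), lintegral_ridge hξ hq hq0 hqi]
  · exact ENNReal.ofReal_lt_top
  · exact mul_nonneg (by positivity) (hq0 _)

theorem integral_ridge {ξ : E} (hξ : ξ ≠ 0) {q : ℝ → ℝ} (hq : Measurable q)
    (hq0 : 0 ≤ q) (hqi : Integrable q) :
    ∫ v : E, (‖v‖ ^ finrank ℝ E)⁻¹ * |⟪ξ, v⟫| * q ⟪ξ, v⟫ =
      (volume : Measure E).toSphere.real univ / 2 * ∫ s, q s := by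
  rw [integral_eq_lintegral_of_nonneg_ae
    (Eventually.of_forall fun v => mul_nonneg (by positivity) (hq0 _))
    (Measurable.aestronglyMeasurable (by fun_prop)), lintegral_ridge hξ hq hq0 hqi,
    ENNReal.toReal_ofReal (mul_nonneg (by positivity) (integral_nonneg hq0))]

end Ridge

/-- Half the area of the unit sphere of `ℝⁿ`. -/
theorem toSphere_real_univ_div_two {n : ℕ} (hn : 1 ≤ n) :
    (volume : Measure (EuclideanSpace ℝ (Fin n))).toSphere.real univ / 2 =
      Real.pi ^ ((n : ℝ) / 2) / Real.Gamma ((n : ℝ) / 2) := by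
  have hn' : (0 : ℝ) < n := by exact_mod_cast hn
  have : Nonempty (Fin n) := ⟨⟨0, hn⟩⟩
  have hG : 0 < Real.Gamma ((n : ℝ) / 2) := Real.Gamma_pos_of_pos (by positivity)
  -- The area is `n` times the ball volume, and `Γ(n/2 + 1) = (n/2) Γ(n/2)` absorbs `n/2`.
  rw [Measure.toSphere_real_apply_univ, measureReal_def, EuclideanSpace.volume_ball,
    finrank_euclideanSpace_fin, Fintype.card_fin, Real.Gamma_add_one (by positivity),
    ENNReal.ofReal_one, one_pow, one_mul, ENNReal.toReal_ofReal (by positivity),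
    Real.sqrt_eq_rpow, ← Real.rpow_natCast (Real.pi ^ (1 / 2 : ℝ)), ← Real.rpow_mul Real.pi_pos.le,
    one_div_mul_eq_div]
  field_simp

theorem inversionConst_mul {n : ℕ} (hn : 1 ≤ n) {h : 𝓢(ℝ, ℂ)} (hh : h ≠ 0) :
    inversionConst n h * ((volume : Measure (EuclideanSpace ℝ (Fin n))).toSphere.real univ / 2 *
      ∫ t : ℝ, ‖fourierHat h (-t)‖ ^ 2) = 1 := by
  have hn' : (0 : ℝ) < n := by exact_mod_cast hn
  have hG : 0 < Real.Gamma ((n : ℝ) / 2) := Real.Gamma_pos_of_pos (by positivity)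
  have hI := integral_norm_sq_fourierHat_neg_ne_zero hh
  have hp : 0 < Real.pi ^ ((n : ℝ) / 2) := by positivity
  rw [inversionConst, toSphere_real_univ_div_two hn, Real.rpow_neg Real.pi_pos.le]
  field_simp

/-! ### Fubini and Fourier inversion -/

section Ray

variable {n : ℕ}

local notation "V" => EuclideanSpace ℝ (Fin n)

/-- The nonnegative kernel relating the backprojection of the windowed ray transform of `f`
to the Fourier transform of `f`. -/
noncomputable def rayKernel (h : ℝ → ℂ) (ξ v : V) : ℝ :=
  (‖v‖ ^ finrank ℝ V)⁻¹ * |⟪ξ, v⟫| * (2 * Real.pi * ‖fourierHat h (-(2 * Real.pi * ⟪ξ, v⟫))‖ ^ 2)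

theorem rayKernel_nonneg (h : ℝ → ℂ) (ξ v : V) : 0 ≤ rayKernel h ξ v := by
  unfold rayKernel
  positivity

theorem measurable_fourierHat (h : 𝓢(ℝ, ℂ)) : Measurable (fourierHat h) := by
  obtain ⟨A, hA⟩ := exists_schwartzMap_eq_fourierHat h
  exact hA ▸ A.continuous.measurable

theorem measurable_rayKernel (h : 𝓢(ℝ, ℂ)) :
    Measurable fun p : V × V => rayKernel h p.2 p.1 := by
  have := measurable_fourierHat h
  unfold rayKernel
  fun_prop

theorem integrable_rayKernel_and_integral (h : 𝓢(ℝ, ℂ)) {ξ : V} (hξ : ξ ≠ 0) :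
    Integrable (rayKernel h ξ) ∧ ∫ v, rayKernel h ξ v =
      (volume : Measure V).toSphere.real univ / 2 * ∫ t : ℝ, ‖fourierHat h (-t)‖ ^ 2 := by
  have hpi : 2 * Real.pi ≠ 0 := by positivity
  have hm := measurable_fourierHat h
  have hq : Measurable fun s : ℝ => 2 * Real.pi * ‖fourierHat h (-(2 * Real.pi * s))‖ ^ 2 := by
    fun_prop
  have hq0 : 0 ≤ fun s : ℝ => 2 * Real.pi * ‖fourierHat h (-(2 * Real.pi * s))‖ ^ 2 :=
    fun s => by positivity
  have hqi : Integrable fun s : ℝ => 2 * Real.pi * ‖fourierHat h (-(2 * Real.pi * s))‖ ^ 2 :=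
    ((integrable_norm_sq_fourierHat_neg h).comp_mul_left' hpi).const_mul _
  refine ⟨integrable_ridge hξ hq hq0 hqi, (integral_ridge hξ hq hq0 hqi).trans ?_⟩
  rw [integral_const_mul, Measure.integral_comp_mul_left (fun t => ‖fourierHat h (-t)‖ ^ 2),
    abs_of_pos (by positivity), smul_eq_mul, mul_inv_cancel_left₀ hpi]

/-- Integrating in `v` first, the kernel has the same mass for every `ξ ≠ 0`, so the norm integrates
to a constant times `|𝓕 f|`. -/
theorem integrable_fourierAt_mul_rayKernel (hn : 1 ≤ n) (h : 𝓢(ℝ, ℂ)) (f : 𝓢(V, ℂ)) (x : V) :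
    Integrable (fun p : V × V => fourierAt f x p.2 * (rayKernel h p.2 p.1 : ℂ))
      (volume.prod volume) := by
  have : Nonempty (Fin n) := ⟨⟨0, hn⟩⟩
  have hm : Measurable fun p : V × V => fourierAt f x p.2 * (rayKernel h p.2 p.1 : ℂ) :=
    ((continuous_fourierAt f x).measurable.comp measurable_snd).mul
      (Complex.measurable_ofReal.comp (measurable_rayKernel h))
  have hne : ∀ᵐ ξ : V, ξ ≠ 0 := Measure.ae_ne volume 0
  rw [integrable_prod_iff' hm.aestronglyMeasurable]
  refine ⟨?_, ((integrable_fourierAt f x).norm.mul_const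
    ((volume : Measure V).toSphere.real univ / 2 * ∫ t : ℝ, ‖fourierHat h (-t)‖ ^ 2)).congr ?_⟩
  · filter_upwards [hne] with ξ hξ
    exact (integrable_rayKernel_and_integral h hξ).1.ofReal.const_mul _
  · filter_upwards [hne] with ξ hξ
    simp_rw [norm_mul, Complex.norm_real, Real.norm_of_nonneg (rayKernel_nonneg h _ _)]
    rw [integral_const_mul, (integrable_rayKernel_and_integral h hξ).2]

theorem integral_windowedRay_mul_conj_rieszInv_mul_inv_norm_pow (h : 𝓢(ℝ, ℂ)) (f : 𝓢(V, ℂ))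
    (x : V) {v : V} (hv : v ≠ 0) :
    (∫ t : ℝ, windowedRay h f (x - t • v) v * conj (rieszInv h t)) * (((‖v‖ ^ n)⁻¹ : ℝ) : ℂ) =
      ∫ ξ, fourierAt f x ξ * (rayKernel h ξ v : ℂ) := by
  rw [integral_windowedRay_mul_conj_rieszInv h f x hv, ← integral_mul_const]
  congr 1 with ξ
  rw [rayKernel, finrank_euclideanSpace_fin, mul_assoc, ← Complex.ofReal_mul]
  congr 2
  ring

theorem integral_integral_fourierAt_mul_rayKernel (hn : 1 ≤ n) (h : 𝓢(ℝ, ℂ)) (f : 𝓢(V, ℂ))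
    (x : V) :
    ∫ v : V, ∫ ξ : V, fourierAt f x ξ * (rayKernel h ξ v : ℂ) =
      f x * (((volume : Measure V).toSphere.real univ / 2 *
        ∫ t : ℝ, ‖fourierHat h (-t)‖ ^ 2 : ℝ) : ℂ) := by
  have : Nonempty (Fin n) := ⟨⟨0, hn⟩⟩
  rw [integral_integral_swap (f := fun v ξ : V => fourierAt f x ξ * (rayKernel h ξ v : ℂ))
    (integrable_fourierAt_mul_rayKernel hn h f x), ← integral_fourierAt f x, ← integral_mul_const]
  refine integral_congr_ae ?_
  filter_upwards [Measure.ae_ne volume (0 : V)] with ξ hξ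
  rw [integral_const_mul, integral_complex_ofReal, (integrable_rayKernel_and_integral h hξ).2]

end Ray

theorem theorem1 {n : ℕ} (hn : 1 ≤ n) (h : 𝓢(ℝ, ℂ)) (hh : h ≠ 0)
    (f : 𝓢(EuclideanSpace ℝ (Fin n), ℂ)) (x : EuclideanSpace ℝ (Fin n)) :
    (∀ v : EuclideanSpace ℝ (Fin n), v ≠ 0 →
      Integrable (fun t : ℝ => windowedRay h f (x - t • v) v * conj (rieszInv h t))) ∧
    Integrable (fun v : EuclideanSpace ℝ (Fin n) =>
      (∫ t : ℝ, windowedRay h f (x - t • v) v * conj (rieszInv h t)) *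
        (((‖v‖ ^ n)⁻¹ : ℝ) : ℂ)) ∧
    f x = (inversionConst n h : ℂ) *
      ∫ v : EuclideanSpace ℝ (Fin n),
        (∫ t : ℝ, windowedRay h f (x - t • v) v * conj (rieszInv h t)) *
          (((‖v‖ ^ n)⁻¹ : ℝ) : ℂ) ∧
    ((∀ t : ℝ, conj (h t) = h t) →
      f x = (inversionConst n h : ℂ) *
        ∫ v : EuclideanSpace ℝ (Fin n),
          (∫ t : ℝ, windowedRay h f (x - t • v) v * rieszInv h t) *
            (((‖v‖ ^ n)⁻¹ : ℝ) : ℂ)) := by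
  have : Nonempty (Fin n) := ⟨⟨0, hn⟩⟩
  -- The multiplier formula needs `v ≠ 0`; as `n ≥ 1`, the origin is null.
  have hae : (fun v : EuclideanSpace ℝ (Fin n) =>
      ∫ ξ, fourierAt f x ξ * (rayKernel h ξ v : ℂ)) =ᵐ[volume] fun v =>
      (∫ t : ℝ, windowedRay h f (x - t • v) v * conj (rieszInv h t)) *
        (((‖v‖ ^ n)⁻¹ : ℝ) : ℂ) := by
    filter_upwards [Measure.ae_ne volume (0 : EuclideanSpace ℝ (Fin n))] with v hv
    exact (integral_windowedRay_mul_conj_rieszInv_mul_inv_norm_pow h f x hv).symm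
  have hinv : f x = (inversionConst n h : ℂ) *
      ∫ v : EuclideanSpace ℝ (Fin n),
        (∫ t : ℝ, windowedRay h f (x - t • v) v * conj (rieszInv h t)) *
          (((‖v‖ ^ n)⁻¹ : ℝ) : ℂ) := by
    rw [← integral_congr_ae hae, integral_integral_fourierAt_mul_rayKernel hn, mul_left_comm,
      ← Complex.ofReal_mul, inversionConst_mul hn hh, Complex.ofReal_one, mul_one]
  refine ⟨fun v hv => integrable_windowedRay_mul_conj_rieszInv h f x hv,
    (integrable_fourierAt_mul_rayKernel hn h f x).integral_prod_left.congr hae, hinv,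
    fun hr => ?_⟩
  simpa only [conj_rieszInv_of_real hr] using hinv
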